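/- All graphs are finite and simple. For an integer $k\ge 0$, write $[k]=\{1,\dots,k\}$; an edge $k$-weighting of a graph $G$ is a map $w:E(G)\to[k]$. Given a total order $\prec$ on $E(G)$ and an edge weighting $w$, each vertex $v$ is assigned the sequence $c(v)=\bigl(w(e_1),\dots,w(e_r)\bigr)$, where $e_1\prec\dots\prec e_r$ are the edges of $G$ incident to $v$. The weighting $w$ properly colours $V(G)$ by sequences (with respect to $\prec$) if $c(u)\ne c(v)$ for every edge $uv\in E(G)$. Let $\chi^e_\sigma(G)$ be the smallest integer $k$ such that for every total order on $E(G)$ there is an edge $k$-weighting of $G$ that properly colours $V(G)$ by sequences ($\chi^e_\sigma(G)=\infty$ if there is no such $k$). The girth of a graph that contains a cycle is the length of a shortest cycle. **Corollary.** Let $d$ and $g$ be natural numbers with $d\neq 4$ and $g\ge 5$, and let $G$ be a $d$-regular graph with girth $g$ (in particular, $G$ contains a cycle). Then $\chi^e_\sigma(G)\le 3$. -/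

import Mathlib

namespace SeqColouring

/-- An edge `k`-weighting of `G`: every edge receives a number from `[k] = {1, …, k}`. -/
abbrev EdgeWeighting {V : Type*} (G : SimpleGraph V) (k : ℕ) : Type _ :=
  G.edgeSet → Set.Icc (1 : ℕ) k

/-- The finite set `{e ∈ E(G) : v ∈ e}` of the edges of `G` that are incident to `v`. -/
noncomputable def incidentEdges {V : Type*} [Finite V] (G : SimpleGraph V) (v : V) :
    Finset G.edgeSet :=
  (Set.toFinite {e : G.edgeSet | v ∈ (e : Sym2 V)}).toFinset

/-- The sequence of weights at `v`: the edges incident to `v` are listed in increasing order with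
respect to the total order `ord` on `E(G)`, and each edge is replaced by its weight. -/
noncomputable def seqAt {V : Type*} [Finite V] {G : SimpleGraph V} {S : Type*}
    (ord : LinearOrder G.edgeSet) (w : G.edgeSet → S) (v : V) : List S :=
  ((incidentEdges G v).sort ord.le).map w

/-- With respect to the total order `ord` on `E(G)`, the weighting `w` properly colours `V(G)` by
sequences: adjacent vertices receive different sequences. -/
def IsProperBySequences {V : Type*} [Finite V] {G : SimpleGraph V} {S : Type*}
    (ord : LinearOrder G.edgeSet) (w : G.edgeSet → S) : Prop :=
  ∀ u v : V, G.Adj u v → seqAt ord w u ≠ seqAt ord w v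

/-- For every ordering of `E(G)` there is an edge `k`-weighting of `G` that properly colours
`V(G)` by sequences. -/
def SeqWeightable {V : Type*} [Finite V] (G : SimpleGraph V) (k : ℕ) : Prop :=
  ∀ ord : LinearOrder G.edgeSet, ∃ w : EdgeWeighting G k, IsProperBySequences ord w

/-- `χ_σ^e(G)`, the smallest `k` such that for every ordering of `E(G)` there is an edge
`k`-weighting of `G` that properly colours `V(G)` by sequences; it is `⊤` if there is no such
`k`. -/
noncomputable def chiSigma {V : Type*} [Finite V] (G : SimpleGraph V) : ℕ∞ :=
  ⨅ (k : ℕ) (_ : SeqWeightable G k), (k : ℕ∞)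

/-- A `(d, g)`-graph: a `d`-regular graph with girth `g`. Since `g` is a natural number, the graph
contains a cycle, and its shortest cycles have length `g`. -/
def IsRegularGirthGraph {V : Type*} (G : SimpleGraph V) [G.LocallyFinite] (d g : ℕ) : Prop :=
  G.IsRegularOfDegree d ∧ G.egirth = (g : ℕ∞)

end SeqColouring

/-!
Write `E` for the edge set of the `d`-regular graph `G`. Since `G` contains a cycle, `2 ≤ d`.
The idea is to pick, for every edge `e = uv`, a single position at which the sequences of `u` and
`v` will be made to differ.

Since `G` is `d`-regular, its line graph is regular of degree `2 * (d - 1) > 0`, so Hall's theorem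
gives a permutation `φ` of `E` with `φ e` adjacent to `e` in the line graph
(`exists_injective_adj_lineGraph`). If `e = uv` and `φ e` stands at position `i` in the list of
edges at `u`, let `ψ e` be the edge at position `i` in the list of edges at `v`. Then `ψ e ≠ φ e`,
and a weighting with `w (φ e) ≠ w (ψ e)` distinguishes `u` from `v`
(`exists_separating_edge`).

It remains to find `w : E → {1, 2, 3}` with `w x ≠ w (h x)` for all `x`, where `h = ψ ∘ φ⁻¹` has
no fixed points. The graph with edges `x — h x` has at most as many edges as vertices on every
vertex set, so it is 2-degenerate, and greedy colouring uses three colours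
(`exists_colouring_of_fixedPointFree`).
-/

namespace SeqColouring

/-! ### Three-colouring a self-map without fixed points -/

/-- Induction step by degeneracy: a finite set `s` contains a point with at most one `h`-preimage
in `s`; colour the rest first, and then avoid the colours of its image and of that preimage. -/
theorem exists_colouring_on_finset {E S : Type*} [Fintype S] (hS : 3 ≤ Fintype.card S)
    (h : E → E) (hne : ∀ x, h x ≠ x) (s : Finset E) :
    ∃ w : E → S, ∀ x ∈ s, h x ∈ s → w x ≠ w (h x) := by
  classical
  induction s using Finset.strongInduction with
  | H s ih =>
    rcases s.eq_empty_or_nonempty with rfl | hs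
    · have : Nonempty S := Fintype.card_pos_iff.1 (by omega)
      exact ⟨fun _ => Classical.arbitrary S, by simp⟩
    obtain ⟨x, hx, hcard⟩ : ∃ x ∈ s, (s.filter fun y => h y = x).card ≤ 1 := by
      by_contra! hcon
      have h1 : s.card * 2 ≤ ∑ x ∈ s, (s.filter fun y => h y = x).card :=
        smul_eq_mul (a := s.card) (b := 2) ▸
          Finset.card_nsmul_le_sum _ _ _ fun x hx => hcon x hx
      have h2 : ∑ x ∈ s, (s.filter fun y => h y = x).card ≤ s.card := by
        rw [← Finset.card_biUnion]
        · exact Finset.card_le_card fun y hy => by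
            simp only [Finset.mem_biUnion, Finset.mem_filter] at hy
            exact hy.choose_spec.2.1
        · intro a _ b _ hab
          refine Finset.disjoint_left.2 fun y hya hyb => hab ?_
          exact (Finset.mem_filter.1 hya).2.symm.trans (Finset.mem_filter.1 hyb).2
      have := hs.card_pos
      omega
    obtain ⟨w, hw⟩ := ih (s.erase x) (Finset.erase_ssubset hx)
    let bad : Finset S := insert (w (h x)) ((s.filter fun y => h y = x).image w)
    obtain ⟨c, hc⟩ : ∃ c, c ∉ bad := by
      by_contra! hall
      have h1 : bad.card ≤ 2 := (Finset.card_insert_le _ _).trans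
        (Nat.succ_le_succ (Finset.card_image_le.trans hcard))
      rw [Finset.eq_univ_iff_forall.2 hall, Finset.card_univ] at h1
      omega
    refine ⟨Function.update w x c, fun y hy hhy => ?_⟩
    by_cases hyx : y = x
    · subst hyx
      rw [Function.update_self, Function.update_of_ne (hne y)]
      exact fun hcw => hc (Finset.mem_insert.2 (Or.inl hcw))
    · rw [Function.update_of_ne hyx]
      by_cases hhx : h y = x
      · rw [hhx, Function.update_self]
        exact fun hcw => hc (Finset.mem_insert_of_mem
          (Finset.mem_image.2 ⟨y, Finset.mem_filter.2 ⟨hy, hhx⟩, hcw⟩))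
      · rw [Function.update_of_ne hhx]
        exact hw y (Finset.mem_erase.2 ⟨hyx, hy⟩) (Finset.mem_erase.2 ⟨hhx, hhy⟩)

theorem exists_colouring_of_fixedPointFree {E S : Type*} [Finite E] [Fintype S]
    (hS : 3 ≤ Fintype.card S) (h : E → E) (hne : ∀ x, h x ≠ x) :
    ∃ w : E → S, ∀ x, w x ≠ w (h x) := by
  cases nonempty_fintype E
  obtain ⟨w, hw⟩ := exists_colouring_on_finset hS h hne Finset.univ
  exact ⟨w, fun x => hw x (Finset.mem_univ _) (Finset.mem_univ _)⟩

/-! ### The edges at a vertex and the line graph -/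

theorem eq_of_mem_of_mem {V : Type*} {G : SimpleGraph V} {u v : V} (huv : u ≠ v) {e f : G.edgeSet}
    (hue : u ∈ (e : Sym2 V)) (hve : v ∈ (e : Sym2 V))
    (huf : u ∈ (f : Sym2 V)) (hvf : v ∈ (f : Sym2 V)) : e = f :=
  Subtype.ext (((Sym2.mem_and_mem_iff huv).1 ⟨hue, hve⟩).trans
    ((Sym2.mem_and_mem_iff huv).1 ⟨huf, hvf⟩).symm)

section Finite

variable {V : Type*} [Finite V] {G : SimpleGraph V}

theorem mem_incidentEdges {v : V} {e : G.edgeSet} :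
    e ∈ incidentEdges G v ↔ v ∈ (e : Sym2 V) := by
  simp [incidentEdges]

theorem card_incidentEdges [G.LocallyFinite] (v : V) :
    (incidentEdges G v).card = G.degree v := by
  classical
  rw [← G.card_incidenceFinset_eq_degree v,
    ← Finset.card_map (Function.Embedding.subtype (· ∈ G.edgeSet))]
  congr 1
  ext e
  simp [mem_incidentEdges, SimpleGraph.incidenceSet, and_comm]

open Classical in
theorem card_lineGraph_neighbours [G.LocallyFinite] [Fintype G.edgeSet] {d : ℕ}
    (hd : G.IsRegularOfDegree d) (e : G.edgeSet) :
    (Finset.univ.filter fun f => G.lineGraph.Adj e f).card = 2 * (d - 1) := by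
  obtain ⟨⟨u, v⟩, he⟩ := e
  have huv : u ≠ v := G.ne_of_adj he
  let e : G.edgeSet := ⟨s(u, v), he⟩
  have hu : u ∈ (e : Sym2 V) := Sym2.mem_mk_left u v
  have hv : v ∈ (e : Sym2 V) := Sym2.mem_mk_right u v
  have hset : (Finset.univ.filter fun f => G.lineGraph.Adj e f)
      = (incidentEdges G u).erase e ∪ (incidentEdges G v).erase e := by
    ext f
    simp only [Finset.mem_filter, Finset.mem_univ, true_and, Finset.mem_union, Finset.mem_erase,
      mem_incidentEdges, SimpleGraph.lineGraph_adj_iff_exists, ← and_or_left, ne_comm (a := f)]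
    refine and_congr_right fun _ => ⟨?_, ?_⟩
    · rintro ⟨x, hx, hxf⟩
      rcases Sym2.mem_iff.1 hx with rfl | rfl
      · exact Or.inl hxf
      · exact Or.inr hxf
    · rintro (h | h)
      · exact ⟨u, hu, h⟩
      · exact ⟨v, hv, h⟩
  have hdisj : Disjoint ((incidentEdges G u).erase e) ((incidentEdges G v).erase e) := by
    refine Finset.disjoint_left.2 fun f hfu hfv => ?_
    obtain ⟨hfe, hfu⟩ := Finset.mem_erase.1 hfu
    exact hfe (eq_of_mem_of_mem huv (mem_incidentEdges.1 hfu)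
      (mem_incidentEdges.1 (Finset.mem_erase.1 hfv).2) hu hv)
  change (Finset.univ.filter fun f => G.lineGraph.Adj e f).card = _
  rw [hset, Finset.card_union_of_disjoint hdisj,
    Finset.card_erase_of_mem (mem_incidentEdges.2 hu),
    Finset.card_erase_of_mem (mem_incidentEdges.2 hv), card_incidentEdges, card_incidentEdges,
    hd.degree_eq, hd.degree_eq]
  omega

/-- Hall's condition holds because the line graph is regular of positive degree. -/
theorem exists_injective_adj_lineGraph [G.LocallyFinite] {d : ℕ} (hd : G.IsRegularOfDegree d)
    (h2 : 2 ≤ d) :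
    ∃ φ : G.edgeSet → G.edgeSet, Function.Injective φ ∧ ∀ e, G.lineGraph.Adj e (φ e) := by
  classical
  have := Fintype.ofFinite G.edgeSet
  refine (Fintype.all_card_le_filter_rel_iff_exists_injective G.lineGraph.Adj).1 fun A => ?_
  refine Nat.le_of_mul_le_mul_right (c := 2 * (d - 1)) ?_ (by omega)
  refine Finset.card_mul_le_card_mul G.lineGraph.Adj (fun a ha => ?_) fun b _ => ?_
  · rw [← card_lineGraph_neighbours hd a]
    refine Finset.card_le_card fun f hf => ?_
    have hf := (Finset.mem_filter.1 hf).2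
    exact Finset.mem_filter.2 ⟨Finset.mem_filter.2 ⟨Finset.mem_univ _, a, ha, hf⟩, hf⟩
  · rw [← card_lineGraph_neighbours hd b]
    refine Finset.card_le_card fun f hf => ?_
    exact Finset.mem_filter.2 ⟨Finset.mem_univ _, (Finset.mem_filter.1 hf).2.symm⟩

/-! ### Distinguishing the ends of an edge at one position -/

/-- If `e = uv` and `a` is another edge at `u`, then the edge standing at `v` in the position that
`a` has at `u` is different from `a`, as only `e` contains both ends. -/
theorem exists_separating_edge [G.LocallyFinite] {d : ℕ} (hd : G.IsRegularOfDegree d)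
    (ord : LinearOrder G.edgeSet) (S : Type*) {e a : G.edgeSet} (ha : G.lineGraph.Adj e a) :
    ∃ b, b ≠ a ∧ ∀ w : G.edgeSet → S, w a ≠ w b →
      ∀ u v : V, (e : Sym2 V) = s(u, v) → seqAt ord w u ≠ seqAt ord w v := by
  obtain ⟨hea, u, hue, hua⟩ := SimpleGraph.lineGraph_adj_iff_exists.1 ha
  obtain ⟨v, hev⟩ := Sym2.mem_iff_exists.1 hue
  have huv : u ≠ v := G.ne_of_adj (by rw [← SimpleGraph.mem_edgeSet, ← hev]; exact e.2)
  have hve : v ∈ (e : Sym2 V) := hev ▸ Sym2.mem_mk_right u v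
  have hlen (x : V) : ((incidentEdges G x).sort ord.le).length = d := by
    rw [Finset.length_sort, card_incidentEdges, hd.degree_eq]
  obtain ⟨i, hi, hia⟩ := List.getElem_of_mem
    ((Finset.mem_sort ord.le).2 (mem_incidentEdges.2 hua))
  have hi' : i < ((incidentEdges G v).sort ord.le).length := by rw [hlen] at hi ⊢; exact hi
  refine ⟨((incidentEdges G v).sort ord.le)[i], fun hba => hea ?_, fun w hw => ?_⟩
  · have hvb := mem_incidentEdges.1 ((Finset.mem_sort ord.le).1 (List.getElem_mem hi'))
    rw [hba] at hvb
    exact eq_of_mem_of_mem huv hue hve hua hvb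
  · have key : seqAt ord w u ≠ seqAt ord w v := fun heq => hw <| by
      have h := congrArg (fun l => l[i]?) heq
      simpa [seqAt, List.getElem?_eq_getElem hi, List.getElem?_eq_getElem hi', hia] using h
    intro x y hxy
    rcases Sym2.eq_iff.1 (hev.symm.trans hxy) with ⟨rfl, rfl⟩ | ⟨rfl, rfl⟩
    · exact key
    · exact key.symm

theorem seqWeightable_three_of_isRegularOfDegree [G.LocallyFinite] {d : ℕ}
    (hd : G.IsRegularOfDegree d) (h2 : 2 ≤ d) : SeqWeightable G 3 := by
  intro ord
  obtain ⟨φ, hφ, hadj⟩ := exists_injective_adj_lineGraph hd h2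
  choose ψ hne hsep using fun e =>
    exists_separating_edge hd ord (Set.Icc (1 : ℕ) 3) (hadj e)
  let φ' := Equiv.ofBijective φ (Finite.injective_iff_bijective.1 hφ)
  obtain ⟨w, hw⟩ := exists_colouring_of_fixedPointFree (S := Set.Icc (1 : ℕ) 3) (by simp)
    (fun x => ψ (φ'.symm x)) fun x hx => hne (φ'.symm x) (hx.trans (φ'.apply_symm_apply x).symm)
  refine ⟨w, fun u v huv => hsep ⟨s(u, v), huv⟩ w ?_ u v rfl⟩
  have := hw (φ' ⟨s(u, v), huv⟩)
  rwa [φ'.symm_apply_apply] at this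

end Finite

/-! ### Cycles in regular graphs -/

theorem two_le_of_isRegularOfDegree_of_not_isAcyclic {V : Type*} {G : SimpleGraph V}
    [G.LocallyFinite] {d : ℕ} (hd : G.IsRegularOfDegree d) (hG : ¬ G.IsAcyclic) : 2 ≤ d := by
  classical
  simp only [SimpleGraph.IsAcyclic, not_forall, not_not] at hG
  obtain ⟨v, c, hc⟩ := hG
  rw [← hd.degree_eq v, ← SimpleGraph.card_neighborFinset_eq_degree,
    ← Finset.card_pair hc.snd_ne_penultimate]
  refine Finset.card_le_card fun x hx => ?_
  rw [SimpleGraph.mem_neighborFinset]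
  rcases Finset.mem_insert.1 hx with rfl | hx
  · exact c.adj_snd hc.not_nil
  · rw [Finset.mem_singleton.1 hx]
    exact (c.adj_penultimate hc.not_nil).symm

end SeqColouring

theorem corollary2p14 {V : Type*} [Finite V] (G : SimpleGraph V) [G.LocallyFinite] (d g : ℕ)
    (hG : SeqColouring.IsRegularGirthGraph G d g) (hd : d ≠ 4) (hg : 5 ≤ g) :
    SeqColouring.chiSigma G ≤ 3 := by
  have h2 : 2 ≤ d := SeqColouring.two_le_of_isRegularOfDegree_of_not_isAcyclic hG.1 fun h => by
    have htop := hG.2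
    rw [h.egirth_eq_top] at htop
    exact ENat.top_ne_natCast g htop
  exact iInf₂_le 3 (SeqColouring.seqWeightable_three_of_isRegularOfDegree hG.1 h2)
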